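/- **Markov fractions and the fractions $\mu_{n/m}$.** A *Markov triple* is a triple $(q_1,q_2,q_3)$ of positive integers with $q_1^2+q_2^2+q_3^2=3q_1q_2q_3$. A *Markov fraction* is a rational number $x_k$ that is an element of a triple $\left(\frac{p_1}{q_1},\frac{p_2}{q_2},\frac{p_3}{q_3}\right)$, where $(q_1,q_2,q_3)$ is a Markov triple and $p_1,p_2,p_3$ are integers with $p_2q_1-p_1q_2=q_3$ and $p_3q_2-p_2q_3=q_1$. Consider the rooted trivalent plane tree, with two faces adjacent to the root edge and one new face opening at every node. Label its faces in two ways. In the (extended) Stern–Brocot tree, the faces below and above the root edge are labeled $\frac01$ and $\frac10$, and the new face at a node whose incoming edge has labels $\frac{p_1}{q_1}$ below and $\frac{p_2}{q_2}$ above is labeled $\frac{p_1+p_2}{q_1+q_2}$; every reduced fraction $\frac nm$ with $n,m\ge 0$ occurs on exactly one face. In the tree of Markov fractions in $[0,1]$, the faces below and above the root edge are labeled $\frac01$ and $\frac11$, and the new face at a node is labeled $\frac{p'}{q'}$ with $$p'=\frac{p_1q_1+p_2q_2}{p_2q_1-p_1q_2},\qquad q'=\frac{q_1^2+q_2^2}{p_2q_1-p_1q_2},$$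 where $\frac{p_1}{q_1}$ and $\frac{p_2}{q_2}$ are the reduced labels below and above the incoming edge. For coprime integers $m,n\ge 0$, let $\mu_{\frac nm}$ be the label in the second tree of the face labeled $\frac nm$ in the first. **Theorem 2.3 (Triangle paths for Markov fractions).** Let $m\ge 0$ and $n\ge 0$ be coprime integers, let $z_{m,n}=m+n\omega$ with $\omega=\frac12(1+i\sqrt3)$, and let $\alpha$ be the oriented straight line segment from $0$ to $z_{m,n}$. The triangles of the Eisenstein lattice $\mathbb Z+\omega\mathbb Z$ are the triangles $[z,z+1,z+\omega]$ and $[z+1,z+\omega,z+1+\omega]$ with $z\in\mathbb Z+\omega\mathbb Z$. Let $\tau_0=[0,1,\omega]$, and let $\tau_1,\dots,\tau_N$ be the triangles other than $\tau_0$ whose interior $\alpha$ meets, in the order in which $\alpha$ passes through them. This is a well-defined finite sequence. If $(m,n)$ equals $(1,0)$ or $(0,1)$, then it is empty, i.e. $N=0$; otherwise $N\geq 1$, $$\tau_1=[1,\omega,1+\omega],\qquad \tau_N=[z_{m,n}-1,\;z_{m,n}-\omega,\;z_{m,n}].$$ Recursively label the vertices of these triangles with fractions as follows, without cancelling common factors.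 * Label the vertices $0$, $1$ and $\omega$ of $\tau_0$ with $\frac10$, $\frac01$ and $\frac11$, respectively. * If the vertices of $\tau_0,\dots,\tau_{j-1}$ are already labeled, label the remaining vertex of $\tau_j$ with $\frac{p_1+p_2}{q_1+q_2}$, where $\frac{p_1}{q_1}$ and $\frac{p_2}{q_2}$ are the labels of the two vertices that $\tau_j$ shares with $\tau_{j-1}$. This labeling is well defined, and the label at $z_{m,n}$ is the fraction $\mu_{\frac nm}$ in lowest terms, which is a Markov fraction. -/

import Mathlib

namespace MarkovPath

/-! ### Markov fractions -/

/-- Markov triples: positive integer solutions of Markov's equation. -/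
def IsMarkovTriple (q₁ q₂ q₃ : ℤ) : Prop :=
  0 < q₁ ∧ 0 < q₂ ∧ 0 < q₃ ∧ q₁ ^ 2 + q₂ ^ 2 + q₃ ^ 2 = 3 * q₁ * q₂ * q₃

/-- Rational Markov triples. -/
def IsRationalMarkovTriple (x₁ x₂ x₃ : ℚ) : Prop :=
  ∃ p₁ p₂ p₃ q₁ q₂ q₃ : ℤ, IsMarkovTriple q₁ q₂ q₃ ∧
    p₂ * q₁ - p₁ * q₂ = q₃ ∧ p₃ * q₂ - p₂ * q₃ = q₁ ∧
    x₁ = (p₁ : ℚ) / q₁ ∧ x₂ = (p₂ : ℚ) / q₂ ∧ x₃ = (p₃ : ℚ) / q₃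

/-- A Markov fraction is an element of some rational Markov triple. -/
def IsMarkovFraction (x : ℚ) : Prop :=
  ∃ x₁ x₂ x₃ : ℚ, IsRationalMarkovTriple x₁ x₂ x₃ ∧ (x = x₁ ∨ x = x₂ ∨ x = x₃)

/-! ### Labelings of the faces of the rooted trivalent plane tree -/

/-- The faces of the rooted trivalent plane tree: the two faces on either side of the root edge,
and, for every node, the face that opens between the two branches leaving this node.  A node is
given by the list of turns leading from the first node to it, the first turn first;
`false` is a turn into the lower branch, `true` is a turn into the upper branch. -/
inductive TreeFace where
  | lower : TreeFace
  | upper : TreeFace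
  | inner (w : List Bool) : TreeFace

/-- If the faces below and above an edge are labeled `a` and `b`, and if the new face at a node is
labeled with `g p₁ p₂` where `p₁` and `p₂` are the labels of the faces below and above the
edge entering that node, then `nodeLabel g a b w` is the label of the new face at the node
reached from that edge by the turns `w`. -/
def nodeLabel {α : Type*} (g : α → α → α) : α → α → List Bool → α
  | a, b, [] => g a b
  | a, b, false :: w => nodeLabel g a (g a b) w
  | a, b, true :: w => nodeLabel g (g a b) b w

/-- The face labels with labels `a` and `b` below and above the root edge
and generating rule `g`. -/
def faceLabel {α : Type*} (g : α → α → α) (a b : α) : TreeFace → α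
  | .lower => a
  | .upper => b
  | .inner w => nodeLabel g a b w

/-- The Stern–Brocot tree extended to all of `ℚ≥0 ∪ {1/0}`; the pair `(n, m)` stands for the
fraction `n/m`. The generating rule `p₁/q₁, p₂/q₂ ↦ (p₁+p₂)/(q₁+q₂)` is addition of pairs. -/
def sternBrocotLabel : TreeFace → ℕ × ℕ :=
  faceLabel (fun a b => a + b) (0, 1) (1, 0)

/-- The generating rule for the tree of Markov fractions:
`p' = (p₁q₁ + p₂q₂) / (p₂q₁ - p₁q₂)`, `q' = (q₁² + q₂²) / (p₂q₁ - p₁q₂)`,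
where `x = p₁/q₁` and `y = p₂/q₂` are in lowest terms. -/
def markovRule (x y : ℚ) : ℚ :=
  let p₁ : ℚ := x.num
  let q₁ : ℚ := x.den
  let p₂ : ℚ := y.num
  let q₂ : ℚ := y.den
  let p' : ℚ := (p₁ * q₁ + p₂ * q₂) / (p₂ * q₁ - p₁ * q₂)
  let q' : ℚ := (q₁ ^ 2 + q₂ ^ 2) / (p₂ * q₁ - p₁ * q₂)
  p' / q'

/-- The tree of Markov fractions in `[0, 1]`, with root labels `0/1` below and `1/1` above. -/
def markovLabel : TreeFace → ℚ :=
  faceLabel markovRule 0 1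

/-! The faces of the Stern–Brocot tree carry every reduced fraction exactly once. -/

/-- The new label at a node as a combination of the two labels at the root edge. -/
def nodeCoeff : List Bool → ℕ × ℕ
  | [] => (1, 1)
  | false :: w => ((nodeCoeff w).1 + (nodeCoeff w).2, (nodeCoeff w).2)
  | true :: w => ((nodeCoeff w).1, (nodeCoeff w).1 + (nodeCoeff w).2)

theorem nodeLabel_add (w : List Bool) (a b : ℕ × ℕ) :
    nodeLabel (fun a b => a + b) a b w = (nodeCoeff w).1 • a + (nodeCoeff w).2 • b := by
  induction w generalizing a b with
  | nil => simp [nodeLabel, nodeCoeff]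
  | cons t w ih =>
    cases t
    · simp only [nodeLabel, nodeCoeff, ih, add_smul, smul_add]; abel
    · simp only [nodeLabel, nodeCoeff, ih, add_smul, smul_add]; abel

theorem nodeCoeff_pos (w : List Bool) : 0 < (nodeCoeff w).1 ∧ 0 < (nodeCoeff w).2 := by
  induction w with
  | nil => simp [nodeCoeff]
  | cons t w ih => cases t <;> simp only [nodeCoeff] <;> omega

theorem nodeCoeff_coprime (w : List Bool) : (nodeCoeff w).1.Coprime (nodeCoeff w).2 := by
  induction w with
  | nil => simp [nodeCoeff]
  | cons t w ih => cases t <;> simpa [nodeCoeff] using ih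

theorem nodeCoeff_injective : Function.Injective nodeCoeff := by
  intro w
  induction w with
  | nil =>
    intro v h
    match v with
    | [] => rfl
    | t :: v =>
      have := nodeCoeff_pos v
      cases t <;> simp only [nodeCoeff, Prod.mk.injEq] at h <;> omega
  | cons s w ih =>
    intro v h
    have hw := nodeCoeff_pos w
    match v with
    | [] => cases s <;> simp only [nodeCoeff, Prod.mk.injEq] at h <;> omega
    | t :: v =>
      have hv := nodeCoeff_pos v
      cases s <;> cases t <;> simp only [nodeCoeff, Prod.mk.injEq] at h
      · rw [ih (a₂ := v) (Prod.ext (by omega) (by omega))]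
      · omega
      · omega
      · rw [ih (a₂ := v) (Prod.ext (by omega) (by omega))]

theorem exists_nodeCoeff (k : ℕ) : ∀ x y : ℕ, x + y ≤ k → 0 < x → 0 < y → x.Coprime y →
    ∃ w, nodeCoeff w = (x, y) := by
  induction k with
  | zero => intro x y h hx; omega
  | succ k ih =>
    intro x y h hx hy hc
    rcases lt_trichotomy x y with hlt | rfl | hlt
    · obtain ⟨d, rfl⟩ := Nat.exists_eq_add_of_lt hlt
      obtain ⟨w, hw⟩ := ih x (d + 1) (by omega) hx (by omega)
        (by rw [add_assoc] at hc; simpa using hc)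
      exact ⟨true :: w, by simp [nodeCoeff, hw, add_assoc]⟩
    · have : x = 1 := by simpa using hc
      exact ⟨[], by simp [nodeCoeff, this]⟩
    · obtain ⟨d, rfl⟩ := Nat.exists_eq_add_of_lt hlt
      obtain ⟨w, hw⟩ := ih (d + 1) y (by omega) (by omega) hy
        (by rw [add_assoc] at hc; simpa using hc)
      exact ⟨false :: w, by simp [nodeCoeff, hw]; omega⟩

theorem sternBrocotLabel_inner (w : List Bool) :
    sternBrocotLabel (.inner w) = ((nodeCoeff w).2, (nodeCoeff w).1) := by
  simp [sternBrocotLabel, faceLabel, nodeLabel_add]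

theorem sternBrocotLabel_coprime (f : TreeFace) :
    (sternBrocotLabel f).1.Coprime (sternBrocotLabel f).2 := by
  cases f with
  | lower => simp [sternBrocotLabel, faceLabel]
  | upper => simp [sternBrocotLabel, faceLabel]
  | inner w => simpa [sternBrocotLabel_inner] using (nodeCoeff_coprime w).symm

theorem sternBrocotLabel_injective : Function.Injective sternBrocotLabel := by
  intro f g h
  cases f <;> cases g
  case inner.inner w v =>
    simp only [sternBrocotLabel_inner, Prod.mk.injEq] at h
    rw [nodeCoeff_injective (Prod.ext h.2 h.1)]
  case inner.lower w =>
    have := nodeCoeff_pos w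
    simp [sternBrocotLabel_inner] at h
    simp [sternBrocotLabel, faceLabel] at h; omega
  case inner.upper w =>
    have := nodeCoeff_pos w
    simp [sternBrocotLabel_inner] at h
    simp [sternBrocotLabel, faceLabel] at h; omega
  case lower.inner w =>
    have := nodeCoeff_pos w
    simp [sternBrocotLabel_inner] at h
    simp [sternBrocotLabel, faceLabel] at h; omega
  case upper.inner w =>
    have := nodeCoeff_pos w
    simp [sternBrocotLabel_inner] at h
    simp [sternBrocotLabel, faceLabel] at h; omega
  all_goals first | rfl | simp [sternBrocotLabel, faceLabel] at h

theorem exists_sternBrocotLabel (n m : ℕ) (h : n.Coprime m) :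
    ∃ f, sternBrocotLabel f = (n, m) := by
  rcases Nat.eq_zero_or_pos n with rfl | hn
  · have hm : m = 1 := by simpa using h
    exact ⟨.lower, by simp [sternBrocotLabel, faceLabel, hm]⟩
  rcases Nat.eq_zero_or_pos m with rfl | hm
  · have hn1 : n = 1 := by simpa using h
    exact ⟨.upper, by simp [sternBrocotLabel, faceLabel, hn1]⟩
  obtain ⟨w, hw⟩ := exists_nodeCoeff (m + n) m n le_rfl hm hn h.symm
  exact ⟨.inner w, by simp [sternBrocotLabel_inner, hw]⟩

/-- The bijection between the faces of the tree and the reduced fractions `n/m` in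
`ℚ≥0 ∪ {1/0}` given by the labels of the extended Stern–Brocot tree. -/
noncomputable def sternBrocotEquiv : TreeFace ≃ {x : ℕ × ℕ // x.1.Coprime x.2} :=
  Equiv.ofBijective (fun f => ⟨sternBrocotLabel f, sternBrocotLabel_coprime f⟩)
    ⟨fun _ _ h => sternBrocotLabel_injective (congrArg Subtype.val h),
      fun x => (exists_sternBrocotLabel x.1.1 x.1.2 x.2).imp fun _ h => Subtype.ext h⟩

/-- `μ_{n/m}`: the fraction in the tree of Markov fractions on the same face as `n/m` in the
extended Stern–Brocot tree. -/
noncomputable def mu (n m : ℕ) (h : n.Coprime m) : ℚ :=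
  markovLabel (sternBrocotEquiv.symm ⟨(n, m), h⟩)

/-! ### Triangles of the Eisenstein lattice -/

/-- `ω = (1 + i√3) / 2`. -/
noncomputable def omega : ℂ := (1 / 2 : ℂ) * (1 + Complex.I * (Real.sqrt 3 : ℝ))

/-- The point `a + b ω` of the Eisenstein lattice. The lattice points are handled through their
coordinates `(a, b)` with respect to the basis `1, ω`. -/
noncomputable def latticePoint (v : ℤ × ℤ) : ℂ := (v.1 : ℂ) + (v.2 : ℂ) * omega

/-- The vertex sets `{z, z + 1, z + ω}` and `{z + 1, z + ω, z + 1 + ω}` of the triangles of the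
Eisenstein lattice. -/
def IsTriangle (T : Finset (ℤ × ℤ)) : Prop :=
  ∃ a b : ℤ, T = {(a, b), (a + 1, b), (a, b + 1)} ∨
    T = {(a + 1, b), (a, b + 1), (a + 1, b + 1)}

/-- `τ₀ = [0, 1, ω]`. -/
def tau0 : Finset (ℤ × ℤ) := {(0, 0), (1, 0), (0, 1)}

/-- The open triangle in the plane with the given vertices. -/
noncomputable def openTriangle (T : Finset (ℤ × ℤ)) : Set ℂ :=
  interior (convexHull ℝ (latticePoint '' (T : Set (ℤ × ℤ))))

/-- The straight line segment from `0` to `z_{m,n} = m + n ω`, parametrized by `[0, 1]`. -/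
noncomputable def alpha (m n : ℕ) (t : ℝ) : ℂ := (t : ℂ) * latticePoint ((m : ℤ), (n : ℤ))

/-- The segment from `0` to `z_{m,n}` runs through the triangle `T`. -/
def Crosses (m n : ℕ) (T : Finset (ℤ × ℤ)) : Prop :=
  ∃ t ∈ Set.Icc (0 : ℝ) 1, alpha m n t ∈ openTriangle T

/-- The segment from `0` to `z_{m,n}` runs through `S` before it runs through `T`. -/
def CrossesBefore (m n : ℕ) (S T : Finset (ℤ × ℤ)) : Prop :=
  ∃ s ∈ Set.Icc (0 : ℝ) 1, ∃ t ∈ Set.Icc (0 : ℝ) 1, s < t ∧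
    alpha m n s ∈ openTriangle S ∧ alpha m n t ∈ openTriangle T

/-- `τ = [τ₁, …, τ_N]` is the sequence of the triangles of the Eisenstein lattice, other than
`τ₀`, that the segment from `0` to `z_{m,n}` runs through, in the order in which it does so. -/
structure IsTrianglePath (m n : ℕ) (τ : List (Finset (ℤ × ℤ))) : Prop where
  nodup : τ.Nodup
  mem_iff : ∀ T, T ∈ τ ↔ IsTriangle T ∧ T ≠ tau0 ∧ Crosses m n T
  ordered : τ.Pairwise (CrossesBefore m n)

/-! ### Labeling by Farey addition -/

/-- The labels `L` obey the labeling rule for the step from the triangle `S` to the next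
triangle `T`: the two triangles share exactly two vertices, and the remaining vertex of `T` is
labeled with `(p₁ + p₂)/(q₁ + q₂)`, where `p₁/q₁` and `p₂/q₂` are the labels of the shared
vertices. The label `p/q` is recorded as the pair `(p, q)`. -/
def FareyStep (L : ℤ × ℤ → ℤ × ℤ) (S T : Finset (ℤ × ℤ)) : Prop :=
  ∃ u v w : ℤ × ℤ, u ≠ v ∧ S ∩ T = {u, v} ∧ T \ S = {w} ∧
    L w = ((L u).1 + (L v).1, (L u).2 + (L v).2)

/-- `L` is a labeling along the triangle path `τ₀, τ₁, …, τ_N` with `τ = [τ₁, …, τ_N]`. (Its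
values at points that are not vertices of these triangles are irrelevant.) -/
structure IsFareyLabeling (τ : List (Finset (ℤ × ℤ))) (L : ℤ × ℤ → ℤ × ℤ) : Prop where
  zero : L (0, 0) = (1, 0)
  one : L (1, 0) = (0, 1)
  omega : L (0, 1) = (1, 1)
  step : (tau0 :: τ).IsChain (FareyStep L)

end MarkovPath

namespace MarkovPath

/-! ### The lattice path below the segment and its matrices -/

/-! In coordinates `x + yω`, for `m, n > 0`, the segment crosses exactly one lattice edge on each
diagonal `x + y = k` with `0 < k < m + n`. Its lower right end is `(k - h, h)` with `h =
⌊kn/(m+n)⌋`, so these ends trace the lattice path closest below the segment. Between consecutive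
diagonals two Farey additions turn the end labels `(A, B)` into `(2A + B, A + B)` at a horizontal
step and into `(A + B, A + 2B)` at a vertical one. Hence the label at `z_{m,n}` is the first column
of `startMatrix` times a product of step matrices (`IsFareyLabeling.apply_end`).

The tree enters because the path of a mediant is the concatenation of the paths of its two parents
(`height_add_of_le`, `height_add_add`). After conjugation by `startMatrix` the path products are
therefore multiplicative along the Stern–Brocot tree (`cohnMatrix_add`). They are Cohn matrices:
determinant 1, first column `(-p, -q)`, trace `3q`. Multiplying the matrices of two neighbouring
faces reproduces the Markov rule (`IsCohnEdge.exists_mediant`), and determinant 1 makes `p/q`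
reduced.

The geometry reduces to linear inequalities in lattice coordinates. A triangle path is unique
because an open triangle is convex, so the segment never re-enters it. -/

/-- The second coordinate of the `k`-th vertex of the lattice path from `0` to `(m, n)` that runs
closest below the segment. -/
def height (m n k : ℕ) : ℕ := k * n / (m + n)

theorem height_spec {m n : ℕ} (h : 0 < m + n) (k : ℕ) :
    (height m n k : ℤ) * (m + n) ≤ k * n ∧ (k * n : ℤ) < (height m n k + 1) * (m + n) := by
  have h1 := Nat.div_mul_le_self (k * n) (m + n)
  have h2 := Nat.lt_div_mul_add (a := k * n) h
  unfold height
  constructor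
  · exact_mod_cast h1
  · rw [add_mul, one_mul]; exact_mod_cast h2

theorem height_eq {m n k : ℕ} (y : ℕ) (h₁ : (y : ℤ) * (m + n) ≤ k * n)
    (h₂ : (k * n : ℤ) < (y + 1) * (m + n)) : height m n k = y := by
  unfold height
  exact Nat.div_eq_of_lt_le (by exact_mod_cast h₁) (by exact_mod_cast h₂)

theorem height_zero (m n : ℕ) : height m n 0 = 0 := by simp [height]

theorem height_last {m n : ℕ} (h : 0 < m + n) : height m n (m + n) = n := by
  simp [height, Nat.mul_div_cancel_left _ h]

theorem height_one {m n : ℕ} (h : 0 < m) : height m n 1 = 0 := by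
  simp [height]; omega

theorem height_succ (m n k : ℕ) :
    height m n (k + 1) = height m n k ∨ height m n (k + 1) = height m n k + 1 := by
  rcases Nat.eq_zero_or_pos (m + n) with h | h
  · simp [height, h]
  have h1 : height m n k ≤ height m n (k + 1) := Nat.div_le_div_right (by gcongr; omega)
  have h2 : height m n (k + 1) ≤ height m n k + 1 := by
    unfold height
    rw [← Nat.add_div_right _ h]
    exact Nat.div_le_div_right (by nlinarith)
  omega

/-- Since the determinant is 1, a lattice point is an integer combination `α(m₁, n₁) + β(m₂, n₂)`.
It lies weakly below the first segment's line iff `β ≤ 0`, and weakly below the line of the sum iff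
`β ≤ α`. For `0 ≤ k ≤ m₁ + n₁` the identity `e` and integrality make both tests agree at the path
vertex and at its upper left neighbour. -/
theorem height_add_of_le {m₁ n₁ m₂ n₂ k : ℕ} (hdet : m₁ * n₂ = m₂ * n₁ + 1)
    (hk : k ≤ m₁ + n₁) : height (m₁ + m₂) (n₁ + n₂) k = height m₁ n₁ k := by
  have hm₁ : 0 < m₁ := Nat.pos_of_mul_pos_right (by omega : 0 < m₁ * n₂)
  have hn₂ : 0 < n₂ := Nat.pos_of_mul_pos_left (by omega : 0 < m₁ * n₂)
  obtain ⟨h1, h2⟩ := height_spec (n := n₁) (by omega : 0 < m₁ + n₁) k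
  set y : ℤ := (height m₁ n₁ k : ℤ) with hy
  zify at hdet hk hm₁ hn₂
  apply height_eq <;> push_cast <;> rw [← hy]
  · have e : (n₂ * (k - y) - m₂ * y : ℤ) * (m₁ + n₁) + (m₁ * y - n₁ * (k - y)) * (m₂ + n₂) = k := by
      linear_combination (k : ℤ) * hdet
    have hβ : (m₁ * y - n₁ * (k - y) : ℤ) ≤ 0 := by linarith
    have hα : (0 : ℤ) ≤ n₂ * (k - y) - m₂ * y := by
      by_contra! hc
      nlinarith
    linarith
  · have e : (n₂ * (k - y - 1) - m₂ * (y + 1) : ℤ) * (m₁ + n₁)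
        + (m₁ * (y + 1) - n₁ * (k - y - 1)) * (m₂ + n₂) = k := by
      linear_combination (k : ℤ) * hdet
    have hβ : (0 : ℤ) < m₁ * (y + 1) - n₁ * (k - y - 1) := by linarith
    have hα : (n₂ * (k - y - 1) - m₂ * (y + 1) : ℤ) ≤ 0 := by
      by_contra! hc
      nlinarith
    linarith

/-- The same argument for the second half of the path: translation by `(m₁, n₁)` raises `α` by 1, so
the test becomes `β ≤ α + 1`, to be compared with the test `0 ≤ α` for the second segment. -/
theorem height_add_add {m₁ n₁ m₂ n₂ k : ℕ} (hdet : m₁ * n₂ = m₂ * n₁ + 1)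
    (hk : k ≤ m₂ + n₂) :
    height (m₁ + m₂) (n₁ + n₂) (m₁ + n₁ + k) = n₁ + height m₂ n₂ k := by
  have hm₁ : 0 < m₁ := Nat.pos_of_mul_pos_right (by omega : 0 < m₁ * n₂)
  have hn₂ : 0 < n₂ := Nat.pos_of_mul_pos_left (by omega : 0 < m₁ * n₂)
  obtain ⟨h1, h2⟩ := height_spec (n := n₂) (by omega : 0 < m₂ + n₂) k
  set y : ℤ := (height m₂ n₂ k : ℤ) with hy
  zify at hdet hk hm₁ hn₂
  apply height_eq <;> push_cast <;> rw [← hy]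
  · have e : (n₂ * (k - y) - m₂ * y : ℤ) * (m₁ + n₁) + (m₁ * y - n₁ * (k - y)) * (m₂ + n₂) = k := by
      linear_combination (k : ℤ) * hdet
    have hα : (0 : ℤ) ≤ n₂ * (k - y) - m₂ * y := by linarith
    have hβ : (m₁ * y - n₁ * (k - y) : ℤ) ≤ 1 := by
      by_contra! hc
      nlinarith
    linarith
  · have e : (n₂ * (k - y - 1) - m₂ * (y + 1) : ℤ) * (m₁ + n₁)
        + (m₁ * (y + 1) - n₁ * (k - y - 1)) * (m₂ + n₂) = k := by
      linear_combination (k : ℤ) * hdet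
    have hα : (n₂ * (k - y - 1) - m₂ * (y + 1) : ℤ) ≤ -1 := by linarith
    have hβ : (1 : ℤ) ≤ m₁ * (y + 1) - n₁ * (k - y - 1) := by
      by_contra! hc
      nlinarith
    linarith

/-- The change of the labels at the two ends of a diagonal edge under a horizontal (`false`) or a
vertical (`true`) step of the lattice path. -/
def stepMatrix : Bool → Matrix (Fin 2) (Fin 2) ℤ
  | false => !![2, 1; 1, 1]
  | true => !![1, 1; 1, 2]

/-- The product of the step matrices along the first `k` steps of the lattice path. -/
def pathMatrix (m n : ℕ) : ℕ → Matrix (Fin 2) (Fin 2) ℤ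
  | 0 => 1
  | k + 1 => pathMatrix m n k * stepMatrix (decide (height m n (k + 1) ≠ height m n k))

theorem pathMatrix_add_of_le {m₁ n₁ m₂ n₂ k : ℕ} (hdet : m₁ * n₂ = m₂ * n₁ + 1)
    (hk : k ≤ m₁ + n₁) : pathMatrix (m₁ + m₂) (n₁ + n₂) k = pathMatrix m₁ n₁ k := by
  induction k with
  | zero => rfl
  | succ k ih =>
    rw [pathMatrix, pathMatrix, ih (by omega), height_add_of_le hdet hk,
      height_add_of_le hdet (by omega)]

theorem pathMatrix_add_add {m₁ n₁ m₂ n₂ k : ℕ} (hdet : m₁ * n₂ = m₂ * n₁ + 1)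
    (hk : k ≤ m₂ + n₂) : pathMatrix (m₁ + m₂) (n₁ + n₂) (m₁ + n₁ + k) =
      pathMatrix m₁ n₁ (m₁ + n₁) * pathMatrix m₂ n₂ k := by
  induction k with
  | zero => simp [pathMatrix, pathMatrix_add_of_le hdet]
  | succ k ih =>
    rw [← add_assoc, pathMatrix, pathMatrix, ih (by omega), add_assoc _ k 1,
      height_add_add hdet hk, height_add_add hdet (by omega), mul_assoc]
    simp only [ne_eq, Nat.add_left_cancel_iff]

/-- The matrix whose columns are the labels, continued backwards by one step, at the start of the
lattice path. -/
def startMatrix : Matrix (Fin 2) (Fin 2) ℤ := !![-1, 2; 0, 1]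

/-- Being an involution, `startMatrix` cancels between two consecutive conjugated products, so
conjugation preserves concatenation. -/
theorem startMatrix_mul_self : startMatrix * startMatrix = 1 := by decide

/-- The Cohn matrix of the lattice path from `0` to `v.2 + v.1 ω`. -/
def cohnMatrix (v : ℕ × ℕ) : Matrix (Fin 2) (Fin 2) ℤ :=
  startMatrix * pathMatrix v.2 v.1 (v.2 + v.1) * startMatrix

theorem cohnMatrix_add {v₁ v₂ : ℕ × ℕ} (hdet : v₁.2 * v₂.1 = v₂.2 * v₁.1 + 1) :
    cohnMatrix (v₁ + v₂) = cohnMatrix v₁ * cohnMatrix v₂ := by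
  have h := pathMatrix_add_add hdet le_rfl
  rw [cohnMatrix, Prod.snd_add, Prod.fst_add,
    show v₁.2 + v₂.2 + (v₁.1 + v₂.1) = v₁.2 + v₁.1 + (v₂.2 + v₂.1) by omega, h]
  simp only [cohnMatrix, mul_assoc]
  rw [← mul_assoc startMatrix startMatrix, startMatrix_mul_self, one_mul]

/-! ### Markov fractions from Cohn matrices -/

/-- `x = p/q` is the reduced fraction read off the Cohn matrix of `v`. -/
def IsCohnFraction (v : ℕ × ℕ) (x : ℚ) : Prop :=
  ∃ r : ℤ, cohnMatrix v = !![-x.num, r; -x.den, 3 * x.den + x.num] ∧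
    r * x.den = 1 + x.num * (3 * x.den + x.num)

/-- The relation between the labels below and above an edge of the tree. -/
structure IsCohnEdge (v₁ v₂ : ℕ × ℕ) (x₁ x₂ : ℚ) : Prop where
  det : v₁.2 * v₂.1 = v₂.2 * v₁.1 + 1
  left : IsCohnFraction v₁ x₁
  right : IsCohnFraction v₂ x₂
  markov : IsMarkovTriple x₁.den x₂.den (x₂.num * x₁.den - x₁.num * x₂.den)

/-- The product of the two Cohn matrices is again a Cohn matrix: its first column gives the new
fraction, and the Markov equation forces its trace to be `3q`. The invariant passes to both outgoing
edges because the new differences `p q₁ - p₁ q` and `p₂ q - p q₂` are `q₂` and `q₁`. -/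
theorem IsCohnEdge.exists_mediant {v₁ v₂ : ℕ × ℕ} {x₁ x₂ : ℚ} (h : IsCohnEdge v₁ v₂ x₁ x₂) :
    IsCohnEdge v₁ (v₁ + v₂) x₁ (markovRule x₁ x₂) ∧
    IsCohnEdge (v₁ + v₂) v₂ (markovRule x₁ x₂) x₂ ∧
    IsRationalMarkovTriple x₁ (markovRule x₁ x₂) x₂ := by
  obtain ⟨hdet, ⟨r₁, hM₁, hr₁⟩, ⟨r₂, hM₂, hr₂⟩, hq₁, hq₂, hq₃, hmark⟩ := h
  have hM := cohnMatrix_add hdet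
  rw [hM₁, hM₂, Matrix.mul_fin_two] at hM
  set p₁ := x₁.num with hp₁
  set p₂ := x₂.num with hp₂
  set q₁ : ℤ := (x₁.den : ℤ) with hqq₁
  set q₂ : ℤ := (x₂.den : ℤ) with hqq₂
  obtain ⟨q₃, hq₃e⟩ : ∃ q₃, q₃ = p₂ * q₁ - p₁ * q₂ := ⟨_, rfl⟩
  obtain ⟨p, hp⟩ : ∃ p, p = r₁ * q₂ - p₁ * p₂ := ⟨_, rfl⟩
  -- Vieta: `q` is the other root, besides `q₃`, of the Markov equation in its third variable,
  -- whence `q q₃ = q₁² + q₂²`.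
  obtain ⟨q, hq⟩ : ∃ q, q = 3 * q₁ * q₂ - q₃ := ⟨_, rfl⟩
  rw [← hq₃e] at hq₃ hmark
  have hqq : q * q₃ = q₁ ^ 2 + q₂ ^ 2 := by rw [hq]; linear_combination -hmark
  have hqpos : 0 < q := by
    have : 0 < q * q₃ := by rw [hqq]; positivity
    exact pos_of_mul_pos_left this hq₃.le
  have e₁ : p * q₁ - p₁ * q = q₂ := by
    rw [hp, hq, hq₃e]; linear_combination q₂ * hr₁
  have e₂ : p₂ * q - p * q₂ = q₁ := by
    apply mul_right_cancel₀ hq₁.ne'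
    linear_combination (-q₂) * e₁ + hqq - q * hq₃e
  have e₃ : p * q₃ = p₁ * q₁ + p₂ * q₂ := by
    apply mul_right_cancel₀ hq₁.ne'
    linear_combination q₃ * e₁ + p₁ * hqq + q₂ * hq₃e
  -- This is the trace condition on the product; after multiplication by `q₁ q₂` the two determinant
  -- relations reduce it to the Markov equation.
  have htr : r₁ * q₂ + q₁ * r₂ = 2 * p₁ * p₂ + 6 * q₁ * p₂ := by
    apply mul_right_cancel₀ (mul_ne_zero hq₁.ne' hq₂.ne')
    rw [hq₃e] at hmark
    linear_combination q₂ ^ 2 * hr₁ + q₁ ^ 2 * hr₂ + hmark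
  obtain ⟨r, hr⟩ : ∃ r, r = -p₁ * r₂ + r₁ * (3 * q₂ + p₂) := ⟨_, rfl⟩
  have h₂₂ : -q₁ * r₂ + (3 * q₁ + p₁) * (3 * q₂ + p₂) = 3 * q + p := by
    rw [hp, hq, hq₃e]; linear_combination -htr
  have h₂₁ : -q₁ * -p₂ + (3 * q₁ + p₁) * -q₂ = -q := by
    rw [hq, hq₃e]; ring
  have h₁₁ : -p₁ * -p₂ + r₁ * -q₂ = -p := by
    rw [hp]; ring
  have hM' : cohnMatrix (v₁ + v₂) = !![-p, r; -q, 3 * q + p] := by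
    rw [hM, h₂₂, h₂₁, h₁₁, hr]
  have hdet' : r * q = 1 + p * (3 * q + p) := by
    rw [← h₂₂, ← neg_neg q, ← h₂₁, ← neg_neg p, ← h₁₁, hr]
    linear_combination (r₂ * q₂ - p₂ * (3 * q₂ + p₂)) * hr₁ + hr₂
  have hx : markovRule x₁ x₂ = (p : ℚ) / q := by
    have hq₃' : ((q₃ : ℤ) : ℚ) ≠ 0 := by exact_mod_cast hq₃.ne'
    have e₃' : (p₁ * q₁ + p₂ * q₂ : ℚ) = p * q₃ := by exact_mod_cast e₃.symm
    have hqq' : (q₁ ^ 2 + q₂ ^ 2 : ℚ) = q * q₃ := by exact_mod_cast hqq.symm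
    have hq₃e' : (p₂ * q₁ - p₁ * q₂ : ℚ) = q₃ := by exact_mod_cast hq₃e.symm
    have d₁ : (x₁.den : ℚ) = (q₁ : ℚ) := by simp [hqq₁]
    have d₂ : (x₂.den : ℚ) = (q₂ : ℚ) := by simp [hqq₂]
    simp only [markovRule, d₁, d₂, ← hp₁, ← hp₂]
    rw [hq₃e', e₃', hqq', mul_div_cancel_right₀ _ hq₃', mul_div_cancel_right₀ _ hq₃']
  -- The determinant relation is a Bézout identity for `p` and `q`.
  have hcop : p.natAbs.Coprime q.natAbs := by
    rw [← Int.isCoprime_iff_nat_coprime]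
    exact ⟨-(3 * q + p), r, by linear_combination hdet'⟩
  have hnum : (markovRule x₁ x₂).num = p := by
    rw [hx]; exact Rat.num_div_eq_of_coprime hqpos hcop
  have hden : ((markovRule x₁ x₂).den : ℤ) = q := by
    rw [hx]; exact Rat.den_div_eq_of_coprime hqpos hcop
  have hC : IsCohnFraction (v₁ + v₂) (markovRule x₁ x₂) := ⟨r, by rw [hnum, hden]; exact ⟨hM', hdet'⟩⟩
  have hmark' : q₁ ^ 2 + q ^ 2 + q₂ ^ 2 = 3 * q₁ * q * q₂ := by
    rw [hq]; linear_combination hmark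
  refine ⟨⟨?_, ⟨r₁, hM₁, hr₁⟩, hC, ?_⟩, ⟨?_, hC, ⟨r₂, hM₂, hr₂⟩, ?_⟩, ?_⟩
  · simp only [Prod.fst_add, Prod.snd_add]; linarith
  · rw [hnum, hden, ← hp₁, ← hqq₁, e₁]
    exact ⟨hq₁, hqpos, hq₂, hmark'⟩
  · simp only [Prod.fst_add, Prod.snd_add]; linarith
  · rw [hnum, hden, ← hp₂, ← hqq₂, e₂]
    exact ⟨hqpos, hq₂, hq₁, by linear_combination hmark'⟩
  · refine ⟨p₁, p, p₂, q₁, q, q₂, ⟨hq₁, hqpos, hq₂, hmark'⟩, e₁, e₂, ?_, hx, ?_⟩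
    · rw [hp₁, hqq₁, Int.cast_natCast, Rat.num_div_den]
    · rw [hp₂, hqq₂, Int.cast_natCast, Rat.num_div_den]

theorem IsCohnEdge.isCohnFraction_nodeLabel {v₁ v₂ : ℕ × ℕ} {x₁ x₂ : ℚ} (h : IsCohnEdge v₁ v₂ x₁ x₂)
    (w : List Bool) :
    IsCohnFraction (nodeLabel (fun a b => a + b) v₁ v₂ w) (nodeLabel markovRule x₁ x₂ w) ∧
    IsMarkovFraction (nodeLabel markovRule x₁ x₂ w) := by
  induction w generalizing v₁ v₂ x₁ x₂ with
  | nil =>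
    obtain ⟨h₁, -, h₃⟩ := h.exists_mediant
    exact ⟨h₁.right, _, _, _, h₃, Or.inr (Or.inl rfl)⟩
  | cons t w ih =>
    obtain ⟨h₁, h₂, -⟩ := h.exists_mediant
    cases t
    · exact ih h₁
    · exact ih h₂

theorem isCohnEdge_root : IsCohnEdge (0, 1) (1, 0) 0 1 where
  det := rfl
  left := ⟨1, by decide, by simp⟩
  right := ⟨5, by decide, by simp⟩
  markov := by simp [IsMarkovTriple]

theorem isCohnFraction_mu (m n : ℕ) (h : n.Coprime m) :
    IsCohnFraction (n, m) (mu n m h) ∧ IsMarkovFraction (mu n m h) := by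
  obtain ⟨f, hf⟩ := sternBrocotEquiv.surjective ⟨(n, m), h⟩
  have hf' : sternBrocotLabel f = (n, m) := congrArg Subtype.val hf
  have hmu : mu n m h = markovLabel f := by
    rw [mu, ← hf, Equiv.symm_apply_apply]
  rw [hmu, ← hf']
  obtain ⟨-, -, hT⟩ := isCohnEdge_root.exists_mediant
  cases f with
  | lower => exact ⟨isCohnEdge_root.left, _, _, _, hT, Or.inl rfl⟩
  | upper => exact ⟨isCohnEdge_root.right, _, _, _, hT, Or.inr (Or.inr rfl)⟩
  | inner w => exact isCohnEdge_root.isCohnFraction_nodeLabel w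

/-- The right factor `startMatrix` has first column `(-1, 0)`, so it only negates the first column,
which cancels the signs in the Cohn matrix. -/
theorem mu_eq_pathMatrix (m n : ℕ) (h : n.Coprime m) :
    (startMatrix * pathMatrix m n (m + n)) 0 0 = (mu n m h).num ∧
    (startMatrix * pathMatrix m n (m + n)) 1 0 = (mu n m h).den := by
  obtain ⟨⟨r, hM, -⟩, -⟩ := isCohnFraction_mu m n h
  have h0 := congrFun (congrFun hM 0) 0
  have h1 := congrFun (congrFun hM 1) 0
  simp only [cohnMatrix] at h0 h1
  rw [Matrix.mul_apply] at h0 h1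
  simp [Fin.sum_univ_two, startMatrix] at h0 h1 ⊢
  simpa using ⟨h0, h1⟩

/-! ### Triangles of the Eisenstein lattice in coordinates -/

/-- The triangle `[z, z + 1, z + ω]`. -/
def lowerTriangle (a b : ℤ) : Finset (ℤ × ℤ) := {(a, b), (a + 1, b), (a, b + 1)}

/-- The triangle `[z + 1, z + ω, z + 1 + ω]`. -/
def upperTriangle (a b : ℤ) : Finset (ℤ × ℤ) := {(a + 1, b), (a, b + 1), (a + 1, b + 1)}

/-- The real-linear coordinates with respect to the basis `1, ω`. -/
noncomputable def latticeEquiv : (ℝ × ℝ) ≃L[ℝ] ℂ :=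
  LinearEquiv.toContinuousLinearEquiv
    { toFun := fun p => (p.1 : ℂ) + (p.2 : ℂ) * omega
      map_add' := fun p q => by simp only [Prod.fst_add, Prod.snd_add]; push_cast; ring
      map_smul' := fun c p => by
        simp only [Prod.smul_fst, Prod.smul_snd, smul_eq_mul, Complex.real_smul,
          RingHom.id_apply]
        push_cast; ring
      invFun := fun z => (z.re - z.im / Real.sqrt 3, 2 * z.im / Real.sqrt 3)
      left_inv := fun p => by
        have h3 : Real.sqrt 3 ≠ 0 := by positivity
        ext <;> simp [omega] <;> field_simp <;> ring
      right_inv := fun z => by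
        have h3 : Real.sqrt 3 ≠ 0 := by positivity
        apply Complex.ext <;> simp [omega] <;> field_simp <;> ring }

theorem latticeEquiv_apply (p : ℝ × ℝ) : latticeEquiv p = (p.1 : ℂ) + (p.2 : ℂ) * omega := rfl

theorem latticePoint_eq (v : ℤ × ℤ) : latticePoint v = latticeEquiv ((v.1 : ℝ), (v.2 : ℝ)) := by
  simp [latticeEquiv_apply, latticePoint]

theorem alpha_eq (m n : ℕ) (t : ℝ) : alpha m n t = latticeEquiv (t * m, t * n) := by
  simp [latticeEquiv_apply, latticePoint, alpha]; ring

theorem latticeEquiv_mem_openTriangle (T : Finset (ℤ × ℤ)) (p : ℝ × ℝ) :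
    latticeEquiv p ∈ openTriangle T ↔
      p ∈ interior (convexHull ℝ ((fun v : ℤ × ℤ => ((v.1 : ℝ), (v.2 : ℝ))) '' (T : Set (ℤ × ℤ)))) := by
  have h : latticePoint '' (T : Set (ℤ × ℤ)) =
      latticeEquiv '' ((fun v : ℤ × ℤ => ((v.1 : ℝ), (v.2 : ℝ))) '' (T : Set (ℤ × ℤ))) := by
    rw [Set.image_image]; exact Set.image_congr fun v _ => latticePoint_eq v
  rw [openTriangle, h]
  have h2 := (latticeEquiv.toLinearMap).image_convexHull
    ((fun v : ℤ × ℤ => ((v.1 : ℝ), (v.2 : ℝ))) '' (T : Set (ℤ × ℤ)))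
  have h3 := latticeEquiv.toHomeomorph.image_interior
    (convexHull ℝ ((fun v : ℤ × ℤ => ((v.1 : ℝ), (v.2 : ℝ))) '' (T : Set (ℤ × ℤ))))
  change latticeEquiv '' _ = convexHull ℝ (latticeEquiv '' _) at h2
  change latticeEquiv '' _ = interior (latticeEquiv '' _) at h3
  rw [← h2, ← h3]
  exact latticeEquiv.injective.mem_set_image

/-! ### Triangles and their interiors as linear inequalities. -/

theorem isOpenMap_add_prod : IsOpenMap (fun p : ℝ × ℝ => p.1 + p.2) :=
  (ContinuousLinearMap.fst ℝ ℝ ℝ + ContinuousLinearMap.snd ℝ ℝ ℝ).isOpenMap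
    fun x => ⟨(x, 0), by simp⟩

theorem interior_triangle_le (a b c : ℝ) :
    interior {p : ℝ × ℝ | a ≤ p.1 ∧ b ≤ p.2 ∧ p.1 + p.2 ≤ c} =
      {p | a < p.1 ∧ b < p.2 ∧ p.1 + p.2 < c} := by
  change interior (Prod.fst ⁻¹' Set.Ici a ∩ (Prod.snd ⁻¹' Set.Ici b ∩
    (fun p : ℝ × ℝ => p.1 + p.2) ⁻¹' Set.Iic c)) = _
  rw [interior_inter, interior_inter,
    ← isOpenMap_fst.preimage_interior_eq_interior_preimage continuous_fst,
    ← isOpenMap_snd.preimage_interior_eq_interior_preimage continuous_snd,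
    ← isOpenMap_add_prod.preimage_interior_eq_interior_preimage (by fun_prop),
    interior_Ici, interior_Ici, interior_Iic]
  rfl

theorem interior_triangle_ge (a b c : ℝ) :
    interior {p : ℝ × ℝ | p.1 ≤ a ∧ p.2 ≤ b ∧ c ≤ p.1 + p.2} =
      {p | p.1 < a ∧ p.2 < b ∧ c < p.1 + p.2} := by
  change interior (Prod.fst ⁻¹' Set.Iic a ∩ (Prod.snd ⁻¹' Set.Iic b ∩
    (fun p : ℝ × ℝ => p.1 + p.2) ⁻¹' Set.Ici c)) = _
  rw [interior_inter, interior_inter,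
    ← isOpenMap_fst.preimage_interior_eq_interior_preimage continuous_fst,
    ← isOpenMap_snd.preimage_interior_eq_interior_preimage continuous_snd,
    ← isOpenMap_add_prod.preimage_interior_eq_interior_preimage (by fun_prop),
    interior_Ici, interior_Iic, interior_Iic]
  rfl

theorem combination_mem_convexHull {E : Type*} [AddCommGroup E] [Module ℝ E] (A B C : E)
    {u v w : ℝ} (hu : 0 ≤ u) (hv : 0 ≤ v) (hw : 0 ≤ w) (h : u + v + w = 1) :
    u • A + v • B + w • C ∈ convexHull ℝ {A, B, C} := by
  have := (convex_convexHull ℝ {A, B, C}).sum_mem (t := Finset.univ) (w := ![u, v, w])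
    (z := ![A, B, C]) (by simp [Fin.forall_fin_succ, hu, hv, hw])
    (by simpa [Fin.sum_univ_three] using h)
    (by
      intro i _
      apply subset_convexHull
      fin_cases i <;> simp)
  simpa [Fin.sum_univ_three] using this

theorem convexHull_lowerTriangle (a b : ℝ) :
    convexHull ℝ {((a, b) : ℝ × ℝ), (a + 1, b), (a, b + 1)} =
      {p | a ≤ p.1 ∧ b ≤ p.2 ∧ p.1 + p.2 ≤ a + b + 1} := by
  apply Set.Subset.antisymm
  · apply convexHull_min
    · rintro p (rfl | rfl | rfl) <;> simp <;> linarith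
    · intro p hp q hq s t hs ht hst
      simp only [Set.mem_ofPred_eq, Prod.fst_add, Prod.snd_add, Prod.smul_fst, Prod.smul_snd,
        smul_eq_mul] at *
      obtain rfl : s = 1 - t := by linarith
      refine ⟨?_, ?_, ?_⟩ <;> nlinarith
  · rintro ⟨x, y⟩ ⟨hx, hy, hxy⟩
    simp only at hx hy hxy
    convert combination_mem_convexHull ((a, b) : ℝ × ℝ) (a + 1, b) (a, b + 1)
      (u := a + b + 1 - x - y) (v := x - a) (w := y - b) (by linarith) (by linarith) (by linarith)
      (by ring) using 1
    ext <;> simp <;> ring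

theorem convexHull_upperTriangle (a b : ℝ) :
    convexHull ℝ {((a + 1, b) : ℝ × ℝ), (a, b + 1), (a + 1, b + 1)} =
      {p | p.1 ≤ a + 1 ∧ p.2 ≤ b + 1 ∧ a + b + 1 ≤ p.1 + p.2} := by
  apply Set.Subset.antisymm
  · apply convexHull_min
    · rintro p (rfl | rfl | rfl) <;> simp <;> linarith
    · intro p hp q hq s t hs ht hst
      simp only [Set.mem_ofPred_eq, Prod.fst_add, Prod.snd_add, Prod.smul_fst, Prod.smul_snd,
        smul_eq_mul] at *
      obtain rfl : s = 1 - t := by linarith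
      refine ⟨?_, ?_, ?_⟩ <;> nlinarith
  · rintro ⟨x, y⟩ ⟨hx, hy, hxy⟩
    simp only at hx hy hxy
    convert combination_mem_convexHull ((a + 1, b) : ℝ × ℝ) (a, b + 1) (a + 1, b + 1)
      (u := b + 1 - y) (v := a + 1 - x) (w := x + y - a - b - 1)
      (by linarith) (by linarith) (by linarith) (by ring) using 1
    ext <;> simp <;> ring

theorem alpha_mem_lowerTriangle (m n : ℕ) (t : ℝ) (a b : ℤ) :
    alpha m n t ∈ openTriangle (lowerTriangle a b) ↔
      (a : ℝ) < t * m ∧ (b : ℝ) < t * n ∧ t * m + t * n < a + b + 1 := by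
  have h := interior_triangle_le a b (a + b + 1)
  rw [← convexHull_lowerTriangle] at h
  rw [alpha_eq, latticeEquiv_mem_openTriangle]
  simp only [lowerTriangle, Finset.coe_insert, Finset.coe_singleton, Set.image_insert_eq,
    Set.image_singleton]
  push_cast
  rw [h]
  rfl

theorem alpha_mem_upperTriangle (m n : ℕ) (t : ℝ) (a b : ℤ) :
    alpha m n t ∈ openTriangle (upperTriangle a b) ↔
      t * m < a + 1 ∧ t * n < b + 1 ∧ (a : ℝ) + b + 1 < t * m + t * n := by
  have h := interior_triangle_ge (a + 1) (b + 1) (a + b + 1)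
  rw [← convexHull_upperTriangle] at h
  rw [alpha_eq, latticeEquiv_mem_openTriangle]
  simp only [upperTriangle, Finset.coe_insert, Finset.coe_singleton, Set.image_insert_eq,
    Set.image_singleton]
  push_cast
  rw [h]
  rfl

theorem isTriangle_iff (T : Finset (ℤ × ℤ)) :
    IsTriangle T ↔ ∃ a b, T = lowerTriangle a b ∨ T = upperTriangle a b := Iff.rfl

/-! ### The order in which a segment crosses triangles -/

/-- A point of an open triangle lies strictly inside one unit cell, and the diagonal separates the
two triangles of a cell. -/
theorem eq_of_alpha_mem {m n : ℕ} {t : ℝ} {S T : Finset (ℤ × ℤ)} (hS : IsTriangle S)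
    (hT : IsTriangle T) (h₁ : alpha m n t ∈ openTriangle S) (h₂ : alpha m n t ∈ openTriangle T) :
    S = T := by
  obtain ⟨a, b, rfl | rfl⟩ := (isTriangle_iff S).1 hS <;>
  obtain ⟨c, d, rfl | rfl⟩ := (isTriangle_iff T).1 hT <;>
  simp only [alpha_mem_lowerTriangle, alpha_mem_upperTriangle] at h₁ h₂ <;>
  obtain ⟨h1, h2, h3⟩ := h₁ <;> obtain ⟨h4, h5, h6⟩ := h₂
  all_goals
    have e1 : (a : ℝ) < c + 1 := by linarith
    have e2 : (c : ℝ) < a + 1 := by linarith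
    have e3 : (b : ℝ) < d + 1 := by linarith
    have e4 : (d : ℝ) < b + 1 := by linarith
    obtain rfl : a = c := by
      have e1' : a < c + 1 := by exact_mod_cast e1
      have e2' : c < a + 1 := by exact_mod_cast e2
      omega
    obtain rfl : b = d := by
      have e1' : b < d + 1 := by exact_mod_cast e3
      have e2' : d < b + 1 := by exact_mod_cast e4
      omega
    first | rfl | (exfalso; linarith)

theorem alpha_mem_of_mem_Icc {m n : ℕ} {s t r : ℝ} {T : Finset (ℤ × ℤ)} (hT : IsTriangle T)
    (h₁ : alpha m n s ∈ openTriangle T) (h₂ : alpha m n t ∈ openTriangle T)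
    (hr : r ∈ Set.Icc s t) : alpha m n r ∈ openTriangle T := by
  obtain ⟨hs, ht⟩ := hr
  have hm : (0 : ℝ) ≤ m := m.cast_nonneg
  have hn : (0 : ℝ) ≤ n := n.cast_nonneg
  have a1 := mul_le_mul_of_nonneg_right hs hm
  have a2 := mul_le_mul_of_nonneg_right hs hn
  have a3 := mul_le_mul_of_nonneg_right ht hm
  have a4 := mul_le_mul_of_nonneg_right ht hn
  obtain ⟨a, b, rfl | rfl⟩ := (isTriangle_iff T).1 hT <;>
  simp only [alpha_mem_lowerTriangle, alpha_mem_upperTriangle] at h₁ h₂ ⊢ <;>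
  obtain ⟨h1, h2, h3⟩ := h₁ <;> obtain ⟨h4, h5, h6⟩ := h₂ <;>
  refine ⟨?_, ?_, ?_⟩ <;> linarith

/-- The times spent in one open triangle form an interval. If each triangle were visited before the
other, two such intervals would overlap. -/
theorem CrossesBefore.antisymm {m n : ℕ} {S T : Finset (ℤ × ℤ)} (hS : IsTriangle S)
    (hT : IsTriangle T) (h₁ : CrossesBefore m n S T) (h₂ : CrossesBefore m n T S) : S = T := by
  obtain ⟨s, -, t, -, hst, hs, ht⟩ := h₁
  obtain ⟨t', -, s', -, hts, ht', hs'⟩ := h₂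
  rcases le_total s t' with h | h
  · exact eq_of_alpha_mem hS hT (alpha_mem_of_mem_Icc hS hs hs' ⟨h, hts.le⟩) ht'
  · exact eq_of_alpha_mem hS hT hs (alpha_mem_of_mem_Icc hT ht' ht ⟨h, hst.le⟩)

theorem IsTrianglePath.unique {m n : ℕ} {σ τ : List (Finset (ℤ × ℤ))}
    (hσ : IsTrianglePath m n σ) (hτ : IsTrianglePath m n τ) : σ = τ := by
  have hperm : σ.Perm τ := (List.perm_ext_iff_of_nodup hσ.nodup hτ.nodup).2
    fun T => by rw [hσ.mem_iff, hτ.mem_iff]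
  exact hperm.eq_of_pairwise (fun S T h₁ h₂ => CrossesBefore.antisymm ((hσ.mem_iff S).1 h₁).1
    ((hτ.mem_iff T).1 h₂).1) hσ.ordered hτ.ordered

/-! ### The triangle path -/

/-- The first coordinate of the point `c` such that the `k`-th diagonal edge crossed by the
segment joins `c + 1` to `c + ω`. The second coordinate of `c` is `height m n k`. -/
def cornerX (m n k : ℕ) : ℤ := k - 1 - height m n k

/-- The sequence of the triangles crossed by the segment, starting with `τ₀`. -/
def pathTriangle (m n j : ℕ) : Finset (ℤ × ℤ) :=
  if j % 2 = 0 then lowerTriangle (cornerX m n (j / 2 + 1)) (height m n (j / 2 + 1))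
  else upperTriangle (cornerX m n (j / 2 + 1)) (height m n (j / 2 + 1))

/-- A time at which the segment is inside the `j`-th triangle. -/
noncomputable def pathTime (m n j : ℕ) : ℝ :=
  if j % 2 = 0 then (2 * (j / 2 + 1 : ℕ) * (m + n) - 1) / (2 * (m + n) ^ 2)
  else (2 * (j / 2 + 1 : ℕ) * (m + n) + 1) / (2 * (m + n) ^ 2)

theorem pathTriangle_even (m n i : ℕ) : pathTriangle m n (2 * i) =
    lowerTriangle (cornerX m n (i + 1)) (height m n (i + 1)) := by
  simp [pathTriangle]

theorem pathTriangle_odd (m n i : ℕ) : pathTriangle m n (2 * i + 1) =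
    upperTriangle (cornerX m n (i + 1)) (height m n (i + 1)) := by
  have h : (2 * i + 1) / 2 = i := by omega
  simp [pathTriangle, h]

theorem pathTime_even (m n i : ℕ) : pathTime m n (2 * i) =
    (2 * (i + 1 : ℕ) * (m + n) - 1) / (2 * (m + n) ^ 2) := by
  simp [pathTime]

theorem pathTime_odd (m n i : ℕ) : pathTime m n (2 * i + 1) =
    (2 * (i + 1 : ℕ) * (m + n) + 1) / (2 * (m + n) ^ 2) := by
  have h : (2 * i + 1) / 2 = i := by omega
  simp [pathTime, h]

theorem isTriangle_pathTriangle (m n j : ℕ) : IsTriangle (pathTriangle m n j) := by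
  rw [isTriangle_iff, pathTriangle]
  split_ifs
  exacts [⟨_, _, Or.inl rfl⟩, ⟨_, _, Or.inr rfl⟩]

theorem pathTriangle_zero {m : ℕ} (n : ℕ) (hm : 0 < m) : pathTriangle m n 0 = tau0 := by
  simp [pathTriangle, cornerX, height_one hm, lowerTriangle, tau0]

theorem sum_lowerTriangle (a b : ℤ) : ∑ v ∈ lowerTriangle a b, (v.1 + v.2) = 3 * (a + b) + 2 := by
  rw [lowerTriangle, Finset.sum_insert (by simp), Finset.sum_pair (by simp)]
  ring

theorem sum_upperTriangle (a b : ℤ) : ∑ v ∈ upperTriangle a b, (v.1 + v.2) = 3 * (a + b) + 4 := by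
  rw [upperTriangle, Finset.sum_insert (by simp), Finset.sum_pair (by simp)]
  ring

/-- The coordinate sum over the vertices is `3k - 1` for the lower and `3k + 1` for the upper
triangle at diagonal `k`, so it determines the index. -/
theorem pathTriangle_injective (m n : ℕ) : Function.Injective (pathTriangle m n) := by
  intro i j h
  have h' := congrArg (fun T : Finset (ℤ × ℤ) => ∑ v ∈ T, (v.1 + v.2)) h
  simp only [pathTriangle] at h'
  split_ifs at h' <;> simp only [sum_lowerTriangle, sum_upperTriangle, cornerX] at h' <;> omega

theorem pathTime_strictMono {m n : ℕ} (h : 1 < m + n) : StrictMono (pathTime m n) := by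
  have hK : (1 : ℝ) < m + n := by exact_mod_cast h
  apply strictMono_nat_of_lt_succ
  intro j
  rcases Nat.even_or_odd' j with ⟨i, rfl | rfl⟩
  · rw [pathTime_even, pathTime_odd]
    gcongr
    linarith
  · rw [show 2 * i + 1 + 1 = 2 * (i + 1) by ring, pathTime_even, pathTime_odd]
    gcongr
    push_cast
    nlinarith

/-- By coprimality the segment has no lattice point on an intermediate diagonal; integrality turns
the strict inequalities into a margin of 1. -/
theorem edge_bounds {m n k : ℕ} (hmn : n.Coprime m) (hk : 0 < k) (hkK : k < m + n) :
    (k : ℤ) * n + 1 ≤ (height m n k + 1) * (m + n) ∧ (height m n k : ℤ) * (m + n) + 1 ≤ k * n := by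
  obtain ⟨h1, h2⟩ := height_spec (n := n) (by omega : 0 < m + n) k
  refine ⟨h2, lt_of_le_of_ne h1 fun h => ?_⟩
  have h3 : (m + n) ∣ k * n := ⟨height m n k, by rw [mul_comm (m + n)]; exact_mod_cast h.symm⟩
  have h4 : (m + n).Coprime n := by simpa using hmn.symm
  exact absurd (Nat.le_of_dvd hk (h4.dvd_of_dvd_mul_right h3)) (by omega)

/-- The segment meets diagonal `k` at time `k/(m+n)`, at distance at least `1/(m+n)` in each
coordinate from the ends of the edge. `pathTime` shifts this time by `1/(2(m+n)²)`, which moves each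
coordinate by at most `1/(2(m+n))`: enough to leave the edge, too little to leave the triangle. -/
theorem alpha_pathTime_mem {m n j : ℕ} (hmn : n.Coprime m) (hj : j < 2 * (m + n) - 2) :
    pathTime m n j ∈ Set.Icc (0 : ℝ) 1 ∧
      alpha m n (pathTime m n j) ∈ openTriangle (pathTriangle m n j) := by
  obtain ⟨i, hi⟩ := Nat.even_or_odd' j
  obtain ⟨k, hk⟩ : ∃ k, k = i + 1 := ⟨_, rfl⟩
  have hk0 : 0 < k := by omega
  have hkK : k < m + n := by omega
  obtain ⟨h1, h2⟩ := edge_bounds hmn hk0 hkK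
  have h1' : (k : ℝ) * n + 1 ≤ (height m n k + 1) * (m + n) := by exact_mod_cast h1
  have h2' : (height m n k : ℝ) * (m + n) + 1 ≤ k * n := by exact_mod_cast h2
  have hk1 : (1 : ℝ) ≤ k := by exact_mod_cast hk0
  have hkK' : (k : ℝ) + 1 ≤ m + n := by exact_mod_cast hkK
  have hm : (0 : ℝ) ≤ m := m.cast_nonneg
  have hn : (0 : ℝ) ≤ n := n.cast_nonneg
  have hK : (0 : ℝ) < m + n := by linarith
  have hK2 : (0 : ℝ) < 2 * (m + n) ^ 2 := by positivity
  rcases hi with rfl | rfl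
  · rw [pathTime_even, pathTriangle_even, ← hk, alpha_mem_lowerTriangle, ← mul_add,
      div_mul_eq_mul_div, div_mul_eq_mul_div, div_mul_eq_mul_div, lt_div_iff₀ hK2,
      lt_div_iff₀ hK2, div_lt_iff₀ hK2, cornerX]
    push_cast
    refine ⟨⟨div_nonneg (by nlinarith) hK2.le, (div_le_one hK2).2 (by nlinarith)⟩, ?_, ?_, ?_⟩
    · nlinarith
    · nlinarith
    · nlinarith
  · rw [pathTime_odd, pathTriangle_odd, ← hk, alpha_mem_upperTriangle, ← mul_add,
      div_mul_eq_mul_div, div_mul_eq_mul_div, div_mul_eq_mul_div, div_lt_iff₀ hK2,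
      div_lt_iff₀ hK2, lt_div_iff₀ hK2, cornerX]
    push_cast
    refine ⟨⟨div_nonneg (by nlinarith) hK2.le, (div_le_one hK2).2 (by nlinarith)⟩, ?_, ?_, ?_⟩
    · nlinarith
    · nlinarith
    · nlinarith

/-- Eliminating `t` gives `bm < (a+1)n` and `an < (b+1)m`, which say precisely that `b` is the
height on diagonal `a + b + 1`. -/
theorem corner_of_mem {m n : ℕ} (hm : 0 < m) (hn : 0 < n) {t : ℝ} (ht : t ∈ Set.Icc (0 : ℝ) 1)
    {a b : ℤ} (ha : (a : ℝ) < t * m) (ha' : t * m < a + 1) (hb : (b : ℝ) < t * n)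
    (hb' : t * n < b + 1) :
    ∃ i, i + 1 < m + n ∧ a = cornerX m n (i + 1) ∧ b = height m n (i + 1) := by
  obtain ⟨ht0, ht1⟩ := ht
  have hm' : (0 : ℝ) < m := by exact_mod_cast hm
  have hn' : (0 : ℝ) < n := by exact_mod_cast hn
  have a0 : (-1 : ℝ) < a := by nlinarith
  have b0 : (-1 : ℝ) < b := by nlinarith
  have a1 : (a : ℝ) < m := by nlinarith
  have b1 : (b : ℝ) < n := by nlinarith
  have e1 : (b : ℝ) * m < (a + 1) * n := by nlinarith
  have e2 : (a : ℝ) * n < (b + 1) * m := by nlinarith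
  have a0' : -1 < a := by exact_mod_cast a0
  have b0' : -1 < b := by exact_mod_cast b0
  have a1' : a < m := by exact_mod_cast a1
  have b1' : b < n := by exact_mod_cast b1
  have e1' : b * m < (a + 1) * n := by exact_mod_cast e1
  have e2' : a * n < (b + 1) * m := by exact_mod_cast e2
  obtain ⟨a, rfl⟩ := Int.eq_ofNat_of_zero_le (by omega : 0 ≤ a)
  obtain ⟨b, rfl⟩ := Int.eq_ofNat_of_zero_le (by omega : 0 ≤ b)
  have h : height m n (a + b + 1) = b := height_eq b (by push_cast; linarith) (by push_cast; linarith)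
  exact ⟨a + b, by omega, by rw [cornerX, h]; push_cast; ring, by rw [h]⟩

theorem exists_pathTriangle_of_crosses {m n : ℕ} (hm : 0 < m) (hn : 0 < n) {T : Finset (ℤ × ℤ)}
    (hT : IsTriangle T) (h : Crosses m n T) : ∃ j < 2 * (m + n) - 2, pathTriangle m n j = T := by
  obtain ⟨t, ht, h⟩ := h
  obtain ⟨a, b, rfl | rfl⟩ := (isTriangle_iff T).1 hT
  · rw [alpha_mem_lowerTriangle] at h
    obtain ⟨h1, h2, h3⟩ := h
    obtain ⟨i, hi, rfl, rfl⟩ := corner_of_mem hm hn ht h1 (by linarith) h2 (by linarith)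
    exact ⟨2 * i, by omega, pathTriangle_even m n i⟩
  · rw [alpha_mem_upperTriangle] at h
    obtain ⟨h1, h2, h3⟩ := h
    obtain ⟨i, hi, rfl, rfl⟩ := corner_of_mem hm hn ht (by linarith) h1 (by linarith) h2
    exact ⟨2 * i + 1, by omega, pathTriangle_odd m n i⟩

/-- The triangles other than `τ₀` crossed by the segment from `0` to `m + n ω`, if `m` and `n` are
positive. -/
def trianglePath (m n : ℕ) : List (Finset (ℤ × ℤ)) :=
  (List.range (2 * (m + n) - 3)).map fun j => pathTriangle m n (j + 1)

theorem tau0_cons_trianglePath {m : ℕ} (n : ℕ) (hm : 0 < m) :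
    tau0 :: trianglePath m n = (List.range (2 * (m + n) - 3 + 1)).map (pathTriangle m n) := by
  rw [List.range_succ_eq_map, List.map_cons, pathTriangle_zero n hm, List.map_map]
  rfl

theorem isTrianglePath_trianglePath {m n : ℕ} (hm : 0 < m) (hn : 0 < n) (hmn : n.Coprime m) :
    IsTrianglePath m n (trianglePath m n) where
  nodup := List.Nodup.map (fun i j h => by simpa using pathTriangle_injective m n h)
    List.nodup_range
  mem_iff T := by
    simp only [trianglePath, List.mem_map, List.mem_range]
    constructor
    · rintro ⟨j, hj, rfl⟩
      refine ⟨isTriangle_pathTriangle _ _ _, ?_, _, alpha_pathTime_mem hmn (by omega)⟩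
      rw [← pathTriangle_zero n hm]
      exact fun h => by simpa using pathTriangle_injective m n h
    · rintro ⟨hT, hne, hc⟩
      obtain ⟨j, hj, rfl⟩ := exists_pathTriangle_of_crosses hm hn hT hc
      cases j with
      | zero => exact absurd (pathTriangle_zero n hm) hne
      | succ j => exact ⟨j, by omega, rfl⟩
  ordered := by
    rw [trianglePath, List.pairwise_map]
    refine List.Pairwise.imp_of_mem (fun {i j} hi hj hij => ?_) List.pairwise_lt_range
    rw [List.mem_range] at hi hj
    obtain ⟨hi1, hi2⟩ := alpha_pathTime_mem (m := m) (n := n) (j := i + 1) hmn (by omega)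
    obtain ⟨hj1, hj2⟩ := alpha_pathTime_mem (m := m) (n := n) (j := j + 1) hmn (by omega)
    exact ⟨_, hi1, _, hj1, pathTime_strictMono (by omega) (by omega), hi2, hj2⟩

theorem height_pred_last {m n : ℕ} (hm : 0 < m) (hn : 0 < n) :
    height m n (m + n - 1) = n - 1 := by
  apply height_eq
  · push_cast [show 1 ≤ n by omega, show 1 ≤ m + n by omega]
    nlinarith
  · push_cast [show 1 ≤ n by omega, show 1 ≤ m + n by omega]
    nlinarith

theorem head?_trianglePath {m n : ℕ} (hm : 0 < m) (hn : 0 < n) :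
    (trianglePath m n).head? = some {(1, 0), (0, 1), (1, 1)} := by
  obtain ⟨N, hN⟩ : ∃ N, 2 * (m + n) - 3 = N + 1 := ⟨2 * (m + n) - 4, by omega⟩
  rw [trianglePath, hN, List.range_succ_eq_map, List.map_cons, List.head?_cons]
  simp [pathTriangle, cornerX, height_one hm, upperTriangle]

theorem getLast?_trianglePath {m n : ℕ} (hm : 0 < m) (hn : 0 < n) :
    (trianglePath m n).getLast? =
      some {((m : ℤ) - 1, (n : ℤ)), ((m : ℤ), (n : ℤ) - 1), ((m : ℤ), (n : ℤ))} := by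
  have hN : 2 * (m + n) - 3 = 2 * (m + n - 2) + 1 := by omega
  rw [trianglePath, hN, List.range_succ, List.map_append, List.map_singleton,
    List.getLast?_append_cons, List.getLast?_singleton, pathTriangle_odd,
    show m + n - 2 + 1 = m + n - 1 by omega, upperTriangle, cornerX, height_pred_last hm hn]
  push_cast [show 1 ≤ n by omega, show 1 ≤ m + n by omega]
  rw [Finset.insert_comm]
  congr 3 <;> ring_nf

/-! ### Labels along the triangle path -/

/-- The shared vertices are determined up to order and the new vertex outright, so the existential
rule is a single symmetric equation. -/
theorem fareyStep_iff {L : ℤ × ℤ → ℤ × ℤ} {S T : Finset (ℤ × ℤ)} {u v w : ℤ × ℤ} (huv : u ≠ v)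
    (h₁ : S ∩ T = {u, v}) (h₂ : T \ S = {w}) : FareyStep L S T ↔ L w = L u + L v := by
  constructor
  · rintro ⟨u', v', w', -, h₁', h₂', h⟩
    obtain rfl : w = w' := by rwa [h₂, Finset.singleton_inj] at h₂'
    rw [h₁] at h₁'
    have h₁'' : ({u, v} : Set (ℤ × ℤ)) = {u', v'} := by
      rw [← Finset.coe_pair, h₁', Finset.coe_pair]
    rcases Set.pair_eq_pair_iff.1 h₁'' with ⟨rfl, rfl⟩ | ⟨rfl, rfl⟩
    · exact h
    · rw [add_comm]; exact h
  · exact fun h => ⟨u, v, w, huv, h₁, h₂, h⟩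

theorem fareyStep_lower_upper (L : ℤ × ℤ → ℤ × ℤ) (a b : ℤ) :
    FareyStep L (lowerTriangle a b) (upperTriangle a b) ↔
      L (a + 1, b + 1) = L (a + 1, b) + L (a, b + 1) := by
  apply fareyStep_iff (by simp) <;> ext ⟨x, y⟩ <;> simp [lowerTriangle, upperTriangle] <;> omega

theorem fareyStep_upper_right (L : ℤ × ℤ → ℤ × ℤ) (a b : ℤ) :
    FareyStep L (upperTriangle a b) (lowerTriangle (a + 1) b) ↔
      L (a + 1 + 1, b) = L (a + 1, b) + L (a + 1, b + 1) := by
  apply fareyStep_iff (by simp) <;> ext ⟨x, y⟩ <;> simp [lowerTriangle, upperTriangle] <;> omega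

theorem fareyStep_upper_up (L : ℤ × ℤ → ℤ × ℤ) (a b : ℤ) :
    FareyStep L (upperTriangle a b) (lowerTriangle a (b + 1)) ↔
      L (a, b + 1 + 1) = L (a, b + 1) + L (a + 1, b + 1) := by
  apply fareyStep_iff (by simp) <;> ext ⟨x, y⟩ <;> simp [lowerTriangle, upperTriangle] <;> omega

/-- The label at the lower right end (`j = 0`) or upper left end (`j = 1`) of the `k`-th diagonal
edge. -/
def edgeLabel (m n k : ℕ) (j : Fin 2) : ℤ × ℤ :=
  ((startMatrix * pathMatrix m n k) 0 j, (startMatrix * pathMatrix m n k) 1 j)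

theorem edgeLabel_succ_of_eq {m n k : ℕ} (h : height m n (k + 1) = height m n k) :
    edgeLabel m n (k + 1) 0 = edgeLabel m n k 0 + (edgeLabel m n k 0 + edgeLabel m n k 1) ∧
      edgeLabel m n (k + 1) 1 = edgeLabel m n k 0 + edgeLabel m n k 1 := by
  simp only [edgeLabel, pathMatrix, ← mul_assoc, h, ne_eq, not_true_eq_false, decide_false, stepMatrix]
  generalize startMatrix * pathMatrix m n k = N
  constructor <;> ext <;> simp [Matrix.mul_apply, Fin.sum_univ_two] <;> ring

theorem edgeLabel_succ_of_ne {m n k : ℕ} (h : height m n (k + 1) ≠ height m n k) :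
    edgeLabel m n (k + 1) 0 = edgeLabel m n k 0 + edgeLabel m n k 1 ∧
      edgeLabel m n (k + 1) 1 = edgeLabel m n k 1 + (edgeLabel m n k 0 + edgeLabel m n k 1) := by
  simp only [edgeLabel, pathMatrix, ← mul_assoc, h, ne_eq, not_false_eq_true, decide_true, stepMatrix]
  generalize startMatrix * pathMatrix m n k = N
  constructor <;> ext <;> simp [Matrix.mul_apply, Fin.sum_univ_two] <;> ring

/-- The columns of `startMatrix` are the fictitious labels `-1/0` and `2/1` on diagonal 0. The sign
at the origin differs from the prescribed `1/0`, which is why `pathLabel` treats that vertex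
separately. -/
theorem edgeLabel_one {m : ℕ} (n : ℕ) (hm : 0 < m) :
    edgeLabel m n 1 0 = (0, 1) ∧ edgeLabel m n 1 1 = (1, 1) := by
  have h := edgeLabel_succ_of_eq (m := m) (n := n) (k := 0)
    (by rw [zero_add, height_one hm, height_zero])
  simpa [edgeLabel, pathMatrix, startMatrix] using h

/-- The labeling of the vertices of the triangle path. -/
def pathLabel (m n : ℕ) (v : ℤ × ℤ) : ℤ × ℤ :=
  if v = (0, 0) then (1, 0)
  else edgeLabel m n (v.1 + v.2).toNat (if v.2 = height m n (v.1 + v.2).toNat then 0 else 1)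

theorem pathLabel_of_add_eq {m n k : ℕ} {v : ℤ × ℤ} (hk : 0 < k) (hv : v.1 + v.2 = k) :
    pathLabel m n v = edgeLabel m n k (if v.2 = height m n k then 0 else 1) := by
  have h : v ≠ (0, 0) := by
    rintro rfl
    simp at hv; omega
  rw [pathLabel, if_neg h, hv, Int.toNat_natCast]

/-! ### The recursive labeling: existence and uniqueness. -/

theorem isChain_trianglePath_iff {m : ℕ} (n : ℕ) (hm : 0 < m) (L : ℤ × ℤ → ℤ × ℤ) :
    (tau0 :: trianglePath m n).IsChain (FareyStep L) ↔
      ∀ j < 2 * (m + n) - 3, FareyStep L (pathTriangle m n j) (pathTriangle m n (j + 1)) := by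
  rw [tau0_cons_trianglePath n hm, List.isChain_map, List.isChain_range]
  rfl

theorem cornerX_succ_of_eq {m n k : ℕ} (h : height m n (k + 1) = height m n k) :
    cornerX m n (k + 1) = cornerX m n k + 1 := by
  rw [cornerX, cornerX, h]; push_cast; ring

theorem cornerX_succ_of_eq_add {m n k : ℕ} (h : height m n (k + 1) = height m n k + 1) :
    cornerX m n (k + 1) = cornerX m n k := by
  rw [cornerX, cornerX, h]; push_cast; ring

/-- The labeling rule along the triangle path, in terms of the corners. -/
theorem isChain_trianglePath_iff_corner {m : ℕ} (n : ℕ) (hm : 0 < m)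
    (L : ℤ × ℤ → ℤ × ℤ) :
    (tau0 :: trianglePath m n).IsChain (FareyStep L) ↔
      (∀ k, 0 < k → k < m + n → L (cornerX m n k + 1, height m n k + 1) =
        L (cornerX m n k + 1, height m n k) + L (cornerX m n k, height m n k + 1)) ∧
      (∀ k, 0 < k → k + 1 < m + n →
        (height m n (k + 1) = height m n k →
          L (cornerX m n k + 1 + 1, height m n k) =
            L (cornerX m n k + 1, height m n k) + L (cornerX m n k + 1, height m n k + 1)) ∧
        (height m n (k + 1) = height m n k + 1 →
          L (cornerX m n k, height m n k + 1 + 1) =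
            L (cornerX m n k, height m n k + 1) + L (cornerX m n k + 1, height m n k + 1))) := by
  rw [isChain_trianglePath_iff n hm]
  constructor
  · refine fun h => ⟨fun k hk hkK => ?_, fun k hk hkK => ?_⟩ <;>
    obtain ⟨i, rfl⟩ := Nat.exists_eq_add_of_lt hk <;> rw [zero_add] at *
    · have := h (2 * i) (by omega)
      rwa [pathTriangle_even, pathTriangle_odd, fareyStep_lower_upper] at this
    · have := h (2 * i + 1) (by omega)
      rw [pathTriangle_odd, show 2 * i + 1 + 1 = 2 * (i + 1) by ring, pathTriangle_even] at this
      refine ⟨fun e => ?_, fun e => ?_⟩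
      · rwa [cornerX_succ_of_eq e, e, fareyStep_upper_right] at this
      · rwa [cornerX_succ_of_eq_add e, e, Nat.cast_add_one, fareyStep_upper_up] at this
  · rintro ⟨h₁, h₂⟩ j hj
    obtain ⟨i, rfl | rfl⟩ := Nat.even_or_odd' j
    · rw [pathTriangle_even, pathTriangle_odd, fareyStep_lower_upper]
      exact h₁ (i + 1) (by omega) (by omega)
    · rw [pathTriangle_odd, show 2 * i + 1 + 1 = 2 * (i + 1) by ring, pathTriangle_even]
      obtain ⟨h₃, h₄⟩ := h₂ (i + 1) (by omega) (by omega)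
      rcases height_succ m n (i + 1) with e | e
      · rw [cornerX_succ_of_eq e, e, fareyStep_upper_right]
        exact h₃ e
      · rw [cornerX_succ_of_eq_add e, e, Nat.cast_add_one, fareyStep_upper_up]
        exact h₄ e

theorem pathLabel_right {m n k : ℕ} (hk : 0 < k) :
    pathLabel m n (cornerX m n k + 1, height m n k) = edgeLabel m n k 0 := by
  rw [pathLabel_of_add_eq hk (by simp only [cornerX]; ring), if_pos rfl]

theorem pathLabel_left {m n k : ℕ} (hk : 0 < k) :
    pathLabel m n (cornerX m n k, height m n k + 1) = edgeLabel m n k 1 := by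
  rw [pathLabel_of_add_eq hk (by simp only [cornerX]; ring), if_neg (by simp)]

/-- The far vertex `c + 1 + ω` lies on the next diagonal: it is the upper left end there after a
horizontal step and the lower right end after a vertical one. -/
theorem pathLabel_far {m n k : ℕ} :
    pathLabel m n (cornerX m n k + 1, height m n k + 1) =
      edgeLabel m n k 0 + edgeLabel m n k 1 := by
  rcases height_succ m n k with e | e
  · rw [← (edgeLabel_succ_of_eq e).2, ← pathLabel_left k.succ_pos, cornerX_succ_of_eq e, e]
  · rw [← (edgeLabel_succ_of_ne (by omega)).1, ← pathLabel_right k.succ_pos,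
      cornerX_succ_of_eq_add e, e, Nat.cast_add_one]

theorem isFareyLabeling_pathLabel {m : ℕ} (n : ℕ) (hm : 0 < m) :
    IsFareyLabeling (trianglePath m n) (pathLabel m n) where
  zero := by simp [pathLabel]
  one := by
    have h := pathLabel_right (m := m) (n := n) one_pos
    rw [(edgeLabel_one n hm).1] at h
    simpa [cornerX, height_one hm] using h
  omega := by
    have h := pathLabel_left (m := m) (n := n) one_pos
    rw [(edgeLabel_one n hm).2] at h
    simpa [cornerX, height_one hm] using h
  step := by
    rw [isChain_trianglePath_iff_corner n hm]
    refine ⟨fun k hk _ => ?_, fun k hk _ => ⟨fun e => ?_, fun e => ?_⟩⟩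
    · rw [pathLabel_far, pathLabel_right hk, pathLabel_left hk]
    · rw [pathLabel_far, pathLabel_right hk, ← (edgeLabel_succ_of_eq e).1,
        ← pathLabel_right k.succ_pos, cornerX_succ_of_eq e, e]
    · rw [pathLabel_far, pathLabel_left hk, ← (edgeLabel_succ_of_ne (by omega)).2,
        ← pathLabel_left k.succ_pos, cornerX_succ_of_eq_add e, e, Nat.cast_add_one]

theorem IsFareyLabeling.eq_edgeLabel {m n : ℕ} (hm : 0 < m) {L : ℤ × ℤ → ℤ × ℤ}
    (hL : IsFareyLabeling (trianglePath m n) L) {k : ℕ} (hk : 1 ≤ k) (hkK : k < m + n) :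
    L (cornerX m n k + 1, height m n k) = edgeLabel m n k 0 ∧
      L (cornerX m n k, height m n k + 1) = edgeLabel m n k 1 := by
  obtain ⟨h₁, h₂⟩ := (isChain_trianglePath_iff_corner n hm L).1 hL.step
  induction k, hk using Nat.le_induction with
  | base => simp [cornerX, height_one hm, edgeLabel_one n hm, hL.one, hL.omega]
  | succ k hk ih =>
    obtain ⟨ih₁, ih₂⟩ := ih (by omega)
    have hfar := h₁ k hk (by omega)
    obtain ⟨hright, hup⟩ := h₂ k hk hkK
    rcases height_succ m n k with e | e
    · rw [cornerX_succ_of_eq e, e, hright e, hfar, ih₁, ih₂]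
      exact ⟨(edgeLabel_succ_of_eq e).1.symm, (edgeLabel_succ_of_eq e).2.symm⟩
    · have e' : height m n (k + 1) ≠ height m n k := by omega
      rw [cornerX_succ_of_eq_add e, e, Nat.cast_add_one, hup e, hfar, ih₁, ih₂]
      exact ⟨(edgeLabel_succ_of_ne e').1.symm, (edgeLabel_succ_of_ne e').2.symm⟩

theorem IsFareyLabeling.apply_end {m n : ℕ} (hm : 0 < m) (hn : 0 < n) {L : ℤ × ℤ → ℤ × ℤ}
    (hL : IsFareyLabeling (trianglePath m n) L) : L (m, n) = edgeLabel m n (m + n) 0 := by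
  obtain ⟨k, hk⟩ : ∃ k, m + n = k + 1 := ⟨m + n - 1, by omega⟩
  obtain ⟨h₁, -⟩ := (isChain_trianglePath_iff_corner n hm L).1 hL.step
  obtain ⟨ih₁, ih₂⟩ := hL.eq_edgeLabel hm (by omega : 1 ≤ k) (by omega)
  have hfar := h₁ k (by omega) (by omega)
  -- The last step of the path is vertical, so the far vertex at diagonal `m + n - 1`, which is
  -- `z_{m,n}`, gets the first column of the full product.
  have hh : height m n k = n - 1 := by
    rw [← height_pred_last hm hn, hk, Nat.add_sub_cancel]
  have hh' : height m n (k + 1) = n := by rw [← hk, height_last (by omega)]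
  rw [ih₁, ih₂, ← (edgeLabel_succ_of_ne (by omega)).1, ← hk] at hfar
  rw [← hfar]
  congr 2 <;> simp only [cornerX, hh] <;> omega

/-! ### Segments along a lattice line, and the label at the end. -/

theorem isTrianglePath_nil {m n : ℕ} (h : m = 0 ∨ n = 0) : IsTrianglePath m n [] where
  nodup := List.nodup_nil
  mem_iff T := by
    refine ⟨fun hT => by simp at hT, ?_⟩
    rintro ⟨hT, -, t, -, ht⟩
    exfalso
    obtain ⟨a, b, rfl | rfl⟩ := (isTriangle_iff T).1 hT <;>
    simp only [alpha_mem_lowerTriangle, alpha_mem_upperTriangle] at ht <;>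
    obtain ⟨h1, h2, h3⟩ := ht <;>
    rcases h with rfl | rfl <;>
    simp only [Nat.cast_zero, mul_zero, zero_add, add_zero] at h1 h2 h3
    all_goals
      first
      | (have e1 : (a : ℝ) < 0 := by linarith
         have e2 : (-1 : ℝ) < a := by linarith
         have e1' : a < 0 := by exact_mod_cast e1
         have e2' : -1 < a := by exact_mod_cast e2
         omega)
      | (have e1 : (b : ℝ) < 0 := by linarith
         have e2 : (-1 : ℝ) < b := by linarith
         have e1' : b < 0 := by exact_mod_cast e1
         have e2' : -1 < b := by exact_mod_cast e2
         omega)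
  ordered := List.Pairwise.nil

theorem exists_isFareyLabeling_nil : ∃ L, IsFareyLabeling [] L :=
  ⟨fun v => if v = (0, 0) then (1, 0) else if v = (1, 0) then (0, 1) else (1, 1),
    by simp, by simp, by simp, List.isChain_singleton _⟩

theorem edgeLabel_end (m n : ℕ) (h : n.Coprime m) :
    edgeLabel m n (m + n) 0 = ((mu n m h).num, ((mu n m h).den : ℤ)) :=
  Prod.ext (mu_eq_pathMatrix m n h).1 (mu_eq_pathMatrix m n h).2

end MarkovPath

theorem theorem2p3 (m n : ℕ) (hmn : n.Coprime m) :
    ∃ τ : List (Finset (ℤ × ℤ)),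
      -- the sequence of triangles crossed after `τ₀` is finite and well defined,
      -- with the first and last triangle as stated
      (∀ σ, MarkovPath.IsTrianglePath m n σ ↔ σ = τ) ∧
      ((m, n) = (1, 0) ∨ (m, n) = (0, 1) → τ = []) ∧
      (¬((m, n) = (1, 0) ∨ (m, n) = (0, 1)) →
        τ.head? = some {(1, 0), (0, 1), (1, 1)} ∧
        τ.getLast? = some {((m : ℤ) - 1, (n : ℤ)), ((m : ℤ), (n : ℤ) - 1), ((m : ℤ), (n : ℤ))}) ∧
      -- the recursive labeling exists, and it labels `m + n ω` with the fraction `μ_{n/m}`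
      (∃ L, MarkovPath.IsFareyLabeling τ L) ∧
      (∀ L, MarkovPath.IsFareyLabeling τ L →
        L ((m : ℤ), (n : ℤ)) =
          ((MarkovPath.mu n m hmn).num, ((MarkovPath.mu n m hmn).den : ℤ))) ∧
      -- which is a Markov fraction
      MarkovPath.IsMarkovFraction (MarkovPath.mu n m hmn) := by
  have hmu := (MarkovPath.isCohnFraction_mu m n hmn).2
  have hend := MarkovPath.edgeLabel_end m n hmn
  by_cases h0 : m = 0 ∨ n = 0
  · have hor : (m, n) = (1, 0) ∨ (m, n) = (0, 1) := by
      rcases h0 with rfl | rfl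
      · exact Or.inr (by simpa using hmn)
      · exact Or.inl (by simpa using hmn)
    have hpath := MarkovPath.isTrianglePath_nil h0
    refine ⟨[], fun σ => ⟨fun h => h.unique hpath, fun h => h ▸ hpath⟩, fun _ => rfl,
      fun h => absurd hor h, MarkovPath.exists_isFareyLabeling_nil, fun L hL => ?_, hmu⟩
    rw [← hend]
    -- Here `z_{m,n}` is `1` or `ω`, a vertex of `τ₀`, so its label is prescribed; the path matrix
    -- product has a single factor.
    rcases hor with h | h <;> obtain ⟨rfl, rfl⟩ := Prod.mk.inj h
    · exact hL.one.trans (by decide)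
    · exact hL.omega.trans (by decide)
  · have hm : 0 < m := by omega
    have hn : 0 < n := by omega
    have hpath := MarkovPath.isTrianglePath_trianglePath hm hn hmn
    refine ⟨MarkovPath.trianglePath m n, fun σ => ⟨fun h => h.unique hpath, fun h => h ▸ hpath⟩,
      fun h => ?_, fun _ => ⟨MarkovPath.head?_trianglePath hm hn,
        MarkovPath.getLast?_trianglePath hm hn⟩,
      ⟨_, MarkovPath.isFareyLabeling_pathLabel n hm⟩,
      fun L hL => (hL.apply_end hm hn).trans hend, hmu⟩
    simp only [Prod.mk.injEq] at h
    omega
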